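/- Let $m\ge 1$ and write $[m]=\{1,\dots,m\}$. Let $\mathfrak R=(R_k,\zeta_k)_{k\in\mathcal K}$ be a reference family: $\mathcal K$ is a finite set, the regions $R_k\subseteq[m]$ are pairwise distinct, and $\zeta_k\in\{0,\dots,|R_k|\}$. Assume that $\mathfrak R$ has a forest structure, i.e. $R_k\cap R_{k'}\in\{R_k,R_{k'},\varnothing\}$ for all $k,k'\in\mathcal K$, and that it is complete, i.e. every leaf (every cell of the partition of $[m]$ generated by the regions) is itself one of the regions. For $S\subseteq[m]$ let $$V^*_{\mathfrak R}(S)=\max\{|S\cap A| : A\subseteq[m],\ |R_k\cap A|\le\zeta_k\ \text{for all } k\in\mathcal K\}.$$ For $k\in\mathcal K$ let $\phi(k)=1+|\{k'\in\mathcal K: R_k\subsetneq R_{k'}\}|$ be its depth, let $H=\max_k\phi(k)$ and $\mathcal K^h=\{k\in\mathcal K:\phi(k)=h\}$. Let $(i_1,\dots,i_m)$ be a permutation of $[m]$, and let $S_t=\{i_1,\dots,i_t\}$, $S_0=\varnothing$. Denote by $k^{(t,h)}$ the element of $\mathcal K^h$ whose region contains $i_t$, if it exists, and by $h_{\max}(t)$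 the largest $h$ for which it exists. Define the sets $\mathcal K^-_t\subseteq\mathcal K$ of saturated regions and the counters $\eta^t_k$ recursively. Start with $\mathcal K^-_0=\{k:\zeta_k=0\}$ and $\eta^0_k=0$ for all $k$. At step $t\ge1$, if $i_t\in\bigcup_{k\in\mathcal K^-_{t-1}}R_k$, nothing changes. Otherwise, for $h=1,2,\dots,h_{\max}(t)$ in this order, increase the counter of $k^{(t,h)}$ by $1$; as soon as the new value of the counter is at least $\zeta_{k^{(t,h)}}$, add $k^{(t,h)}$ to the set of saturated regions and stop the loop. All other counters are unchanged. **Corollary (Easy computation).** For every $t\in\{0,\dots,m-1\}$, $$V^*_{\mathfrak R}(S_{t+1})=\begin{cases}V^*_{\mathfrak R}(S_t) & \text{if } i_{t+1}\in\bigcup_{k\in\mathcal K^-_t}R_k,\\ V^*_{\mathfrak R}(S_t)+1 & \text{otherwise.}\end{cases}$$ Consequently the following practical algorithm is correct. Set $V_0=0$; mark the regions with $\zeta_k=0$ as saturated and set all counters to $0$. For $t=1,\dots,m$: if $i_t$ lies in a marked region, set $V_t=V_{t-1}$; otherwise go down the depths $h=1,\dots,h_{\max}(t)$, find $k^{(t,h)}$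 in $\mathcal K^h$, increase its counter, and if the counter is now at least $\zeta_{k^{(t,h)}}$, mark $k^{(t,h)}$ and leave the loop; then set $V_t=V_{t-1}+1$. It returns $V_t=V^*_{\mathfrak R}(S_t)$ for all $0\le t\le m$. Its running time is $O(m|\mathcal K|)$: there is an absolute constant $C$ such that it uses at most $C\,m\,|\mathcal K|$ elementary operations. Here the regions are stored as a list of indices together with the list of the indices of each depth; the union of the marked regions is tested by scanning the list of regions, and $k^{(t,h)}$ is found by scanning the list of $\mathcal K^h$; and each membership test of a hypothesis in a region, each reading or setting of a mark, each comparison or update of a counter, each loop iteration and each output of a value counts as one elementary operation. -/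

import Mathlib

namespace PostHoc

/-! ## Reference families, forest structure, the interpolation bound -/

/-- A (realised) reference family `(R k, ζ k)`, `k : ι`, on the `m` hypotheses `Fin m`:
distinct regions `R k`, and bounds `ζ k ∈ {0, …, |R k|}`. -/
structure RefFamily (m : ℕ) (ι : Type) where
  R : ι → Finset (Fin m)
  ζ : ι → ℕ
  R_injective : Function.Injective R
  ζ_le_card : ∀ k, ζ k ≤ (R k).card

namespace RefFamily

variable {m : ℕ} {ι : Type} [Fintype ι]

/-- `A` belongs to `𝒜(ℜ)` iff `|R k ∩ A| ≤ ζ k` for all `k`. -/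
def admissible (F : RefFamily m ι) : Finset (Finset (Fin m)) :=
  Finset.univ.filter fun A => ∀ k, (F.R k ∩ A).card ≤ F.ζ k

/-- `V*(S) = max { |S ∩ A| : A ∈ 𝒜(ℜ) }`.  The maximum is over a nonempty finite set,
since `∅ ∈ 𝒜(ℜ)`. -/
def Vstar (F : RefFamily m ι) (S : Finset (Fin m)) : ℕ :=
  F.admissible.sup fun A => (S ∩ A).card

/-- Two regions are nested or disjoint. -/
def IsForest (F : RefFamily m ι) : Prop :=
  ∀ k k', F.R k ∩ F.R k' = F.R k ∨ F.R k ∩ F.R k' = F.R k' ∨ F.R k ∩ F.R k' = ∅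

/-- The leaf (atom) of `x`: the cell containing `x` of the partition of the hypotheses that is
generated by the regions. -/
def leaf (F : RefFamily m ι) (x : Fin m) : Finset (Fin m) :=
  Finset.univ.filter fun y => ∀ k, y ∈ F.R k ↔ x ∈ F.R k

/-- The family is complete when every leaf is one of its regions. -/
def IsComplete (F : RefFamily m ι) : Prop :=
  ∀ x, ∃ k, F.R k = F.leaf x

/-- The depth `φ(k) = 1 + |{k' : R k ⊊ R k'}|`. -/
def depth (F : RefFamily m ι) (k : ι) : ℕ :=
  1 + (Finset.univ.filter fun k' => F.R k ⊂ F.R k').card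

/-- The maximal depth `H`. -/
def height (F : RefFamily m ι) : ℕ :=
  Finset.univ.sup F.depth

/-- The largest depth of a region that contains the hypothesis `i`. -/
def hmax (F : RefFamily m ι) (i : Fin m) : ℕ :=
  (Finset.univ.filter fun k => i ∈ F.R k).sup F.depth

open Classical in
/-- The index at depth `h` of the region that contains `i`, if there is one (in a forest there is
at most one). -/
noncomputable def regionAt (F : RefFamily m ι) (i : Fin m) (h : ℕ) : Option ι :=
  if hk : ∃ k, F.depth k = h ∧ i ∈ F.R k then some hk.choose else none

end RefFamily

/-- `S_t = {i_1, …, i_t}`, where `i_{j+1} = σ j`. -/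
def pathSet {m : ℕ} (σ : Equiv.Perm (Fin m)) (t : ℕ) : Finset (Fin m) :=
  (Finset.univ.filter fun j : Fin m => (j : ℕ) < t).image σ

/-! ## The formal algorithm, which defines `𝒦⁻_t` -/

/-- The variables `𝒫^t`, `𝒦⁻_t` and `η^t` of the formal algorithm. -/
structure FormalState (ι : Type) where
  part : Finset ι
  sat : Finset ι
  eta : ι → ℕ

section Formal

variable {m : ℕ} {ι : Type} [Fintype ι] [DecidableEq ι]

/-- `𝒫^0` indexes the leaves, `𝒦⁻_0 = {k : ζ k = 0}`, `η^0 = 0`. -/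
def formalInit (F : RefFamily m ι) : FormalState ι where
  part := Finset.univ.filter fun k => ∃ x, F.R k = F.leaf x
  sat := Finset.univ.filter fun k => F.ζ k = 0
  eta := fun _ => 0

/-- The inner loop over a list of depths, for the added hypothesis `i`. -/
noncomputable def formalLoop (F : RefFamily m ι) (i : Fin m) :
    List ℕ → FormalState ι → FormalState ι
  | [], s => s
  | h :: hs, s =>
    match F.regionAt i h with
    | none => s
    | some k =>
      let eta' := Function.update s.eta k (s.eta k + 1)
      if eta' k < F.ζ k then
        formalLoop F i hs { s with eta := eta' }
      else
        { part := (s.part.filter fun k' => ¬ F.R k' ⊆ F.R k) ∪ {k}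
          sat := s.sat ∪ {k}
          eta := eta' }

/-- One step: the hypothesis `i` is added. -/
noncomputable def formalStep (F : RefFamily m ι) (i : Fin m) (s : FormalState ι) :
    FormalState ι :=
  if ∃ k ∈ s.sat, i ∈ F.R k then s
  else formalLoop F i (List.range' 1 (F.hmax i)) s

/-- The state after the hypotheses `i_1, …, i_t` have been processed (for `t ≤ m`). -/
noncomputable def formalState (F : RefFamily m ι) (σ : Equiv.Perm (Fin m)) :
    ℕ → FormalState ι
  | 0 => formalInit F
  | t + 1 =>
    if ht : t < m then formalStep F (σ ⟨t, ht⟩) (formalState F σ t) else formalState F σ t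

/-- `𝒦⁻_t`, the saturated regions after step `t`. -/
noncomputable def saturated (F : RefFamily m ι) (σ : Equiv.Perm (Fin m)) (t : ℕ) : Finset ι :=
  (formalState F σ t).sat

end Formal

/-! ## The practical algorithm, with its step count -/

/-- A computation that returns `val` after `cost` elementary operations. -/
structure Timed (α : Type) where
  val : α
  cost : ℕ

namespace Timed

instance : Monad Timed where
  pure a := ⟨a, 0⟩
  bind x f := ⟨(f x.val).val, x.cost + (f x.val).cost⟩

/-- Charge `n` elementary operations. -/
def tick (n : ℕ) : Timed Unit := ⟨(), n⟩

end Timed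

/-- The memory of the practical algorithm: the marks `𝒦⁻` and the counters `η`. -/
structure PracticalState (ι : Type) where
  sat : Finset ι
  eta : ι → ℕ

section Practical

variable {m : ℕ} {ι : Type} [DecidableEq ι]

open Timed

/-- Initialisation of `𝒦⁻` and `η` by a scan of the list of regions; each region costs one reset
of its counter, one comparison of `ζ k` with `0`, and at most one mark. -/
def initState (F : RefFamily m ι) : List ι → Timed (PracticalState ι)
  | [] => pure ⟨∅, fun _ => 0⟩
  | k :: ks => do
    let s ← initState F ks
    tick 2
    if F.ζ k = 0 then do
      tick 1
      pure ⟨insert k s.sat, Function.update s.eta k 0⟩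
    else
      pure ⟨s.sat, Function.update s.eta k 0⟩

/-- Is `i` in the union of the regions marked in `𝒦⁻`?  A scan of the list of regions; reading a
mark costs one, and so does a test of membership of a hypothesis in a region. -/
def testSaturated (F : RefFamily m ι) (i : Fin m) (sat : Finset ι) : List ι → Timed Bool
  | [] => pure false
  | k :: ks => do
    tick 1
    if k ∈ sat then do
      tick 1
      if i ∈ F.R k then pure true else testSaturated F i sat ks
    else testSaturated F i sat ks

/-- Find the region of a stored layer that contains `i`, by a scan of the layer with one
membership test for each region. -/
def findRegion (F : RefFamily m ι) (i : Fin m) : List ι → Timed (Option ι)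
  | [] => pure none
  | k :: ks => do
    tick 1
    if i ∈ F.R k then pure (some k) else findRegion F i ks

/-- The inner loop.  It goes down the stored layers `𝒦^1, 𝒦^2, …`; it ends at the first
layer with no region containing `i` (the depth `h_max` has been passed), or at the first counter
that reaches its bound.  An iteration costs one (loop control) plus the search, and an increment, a
comparison and a mark cost one each. -/
def visitLayers (F : RefFamily m ι) (i : Fin m) :
    List (List ι) → PracticalState ι → Timed (PracticalState ι)
  | [], s => pure s
  | layer :: layers, s => do
    tick 1
    let found ← findRegion F i layer
    match found with
    | none => pure s
    | some k => do
      let eta' := Function.update s.eta k (s.eta k + 1)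
      tick 2
      if eta' k < F.ζ k then
        visitLayers F i layers ⟨s.sat, eta'⟩
      else do
        tick 1
        pure ⟨insert k s.sat, eta'⟩

/-- The main loop over the remaining path, from the current value `V` and the current memory; it
returns the values `V_t` of the remaining steps.  Reading the next hypothesis and writing the
next value cost one each. -/
def curveLoop (F : RefFamily m ι) (regions : List ι) (layers : List (List ι)) :
    List (Fin m) → ℕ → PracticalState ι → Timed (List ℕ)
  | [], _, _ => pure []
  | i :: path, V, s => do
    tick 1
    let b ← testSaturated F i s.sat regions
    if b then do
      tick 1
      let rest ← curveLoop F regions layers path V s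
      pure (V :: rest)
    else do
      let s' ← visitLayers F i layers s
      tick 1
      let rest ← curveLoop F regions layers path (V + 1) s'
      pure ((V + 1) :: rest)

/-- The stored layers `𝒦^1, …, 𝒦^H`, for regions listed in memory in the order `regions`. -/
def storedLayers [Fintype ι] (F : RefFamily m ι) (regions : List ι) : List (List ι) :=
  (List.range' 1 F.height).map fun h => regions.filter fun k => F.depth k = h

/-- The practical algorithm.  Its input is the family, stored as the list `regions` of its
indices and the lists of the indices of each depth, and the path `i_1, …, i_m`; it
returns `V_0, V_1, …, V_m`. -/
def practicalCurve [Fintype ι] (F : RefFamily m ι) (regions : List ι)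
    (σ : Equiv.Perm (Fin m)) : Timed (List ℕ) := do
  tick 1
  let s ← initState F regions
  let rest ← curveLoop F regions (storedLayers F regions) (List.ofFn σ) 0 s
  pure (0 :: rest)

end Practical

end PostHoc

/-! The algorithm is greedy. Let `B` be the set of processed hypotheses that lay in no saturated
region on arrival. `Invariant` records that `B` is admissible, that every saturated region meets `B`
in at least `ζ` points, and that every processed hypothesis outside `B` lies in a saturated region.

These facts force `V*(S) = |B|` (`Invariant.Vstar_eq`). The set `B` is itself a competitor.
Conversely, the union `U` of the saturated regions is a disjoint union of maximal ones, so no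
admissible `A` beats `B` inside `U`, while `S` has only points of `B` outside `U`. A step therefore
raises `V*` exactly when it enlarges `B`. That the invariant survives a step rests on
`formalLoop_spec`.

The practical algorithm simulates the formal one, without the partition. For its cost, the layers
are disjoint, so descending through all of them scans each region at most once: a step costs
`O(|𝒦|)`. -/

namespace PostHoc

/-! ### Depth and nesting in a forest -/

namespace RefFamily

variable {m : ℕ} {ι : Type} [Fintype ι]

theorem depth_lt_depth (F : RefFamily m ι) {j k : ι} (h : F.R j ⊂ F.R k) :
    F.depth k < F.depth j := by
  unfold depth
  refine Nat.add_lt_add_left (Finset.card_lt_card ?_) 1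
  rw [Finset.ssubset_iff_of_subset]
  · exact ⟨k, by simpa using h, by simp⟩
  · intro x hx
    simp only [Finset.mem_filter, Finset.mem_univ, true_and] at hx ⊢
    exact h.trans hx

omit [Fintype ι] in
theorem IsForest.subset_or_subset {F : RefFamily m ι} (hF : F.IsForest) {i : Fin m} {j k : ι}
    (hj : i ∈ F.R j) (hk : i ∈ F.R k) : F.R j ⊆ F.R k ∨ F.R k ⊆ F.R j := by
  rcases hF j k with h | h | h
  · exact Or.inl (Finset.inter_eq_left.1 h)
  · exact Or.inr (Finset.inter_eq_right.1 h)
  · exact absurd (Finset.mem_inter.2 ⟨hj, hk⟩) (by simp [h])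

/-- The regions through a common point form a chain, and strict inclusion strictly increases depth;
so depth reverses inclusion along the chain. -/
theorem IsForest.subset_of_depth_le {F : RefFamily m ι} (hF : F.IsForest) {i : Fin m} {j k : ι}
    (hj : i ∈ F.R j) (hk : i ∈ F.R k) (h : F.depth j ≤ F.depth k) : F.R k ⊆ F.R j := by
  by_contra hkj
  rcases hF.subset_or_subset hj hk with hs | hs
  · exact absurd (F.depth_lt_depth ⟨hs, hkj⟩) (by omega)
  · exact hkj hs

theorem IsForest.eq_of_depth_eq {F : RefFamily m ι} (hF : F.IsForest) {i : Fin m} {j k : ι}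
    (hj : i ∈ F.R j) (hk : i ∈ F.R k) (h : F.depth j = F.depth k) : j = k :=
  F.R_injective (Finset.Subset.antisymm (hF.subset_of_depth_le hk hj h.ge)
    (hF.subset_of_depth_le hj hk h.le))

/-- In a forest, a region of depth at least two that contains `i` has a parent. -/
theorem IsForest.exists_parent {F : RefFamily m ι} (hF : F.IsForest) {i : Fin m} {k : ι}
    (hk : i ∈ F.R k) (h : 1 < F.depth k) : ∃ j, i ∈ F.R j ∧ F.depth j + 1 = F.depth k := by
  classical
  have hne : (Finset.univ.filter fun k' => F.R k ⊂ F.R k').Nonempty := by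
    rw [← Finset.card_pos]
    unfold depth at h
    omega
  -- The parent is the smallest strict superset; every other strict superset contains it strictly.
  obtain ⟨j, hj, hmin⟩ := Finset.exists_min_image _ (fun k' => (F.R k').card) hne
  simp only [Finset.mem_filter, Finset.mem_univ, true_and] at hj hmin
  refine ⟨j, hj.1 hk, ?_⟩
  have heq : (Finset.univ.filter fun k' => F.R k ⊂ F.R k') =
      insert j (Finset.univ.filter fun k' => F.R j ⊂ F.R k') := by
    ext x
    simp only [Finset.mem_filter, Finset.mem_univ, true_and, Finset.mem_insert]
    constructor
    · intro hx
      rcases hF.subset_or_subset (hj.1 hk) (hx.1 hk) with hs | hs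
      · rcases hs.eq_or_ssubset with he | hss
        · exact Or.inl (F.R_injective he.symm)
        · exact Or.inr hss
      · exact Or.inl (F.R_injective (Finset.eq_of_subset_of_card_le hs (hmin x hx)))
    · rintro (rfl | hx)
      · exact hj
      · exact hj.trans hx
  unfold depth
  rw [heq, Finset.card_insert_of_notMem (by simp)]
  omega

/-- In a forest, the depths of the regions that contain `i` form an initial segment. -/
theorem IsForest.exists_depth_eq {F : RefFamily m ι} (hF : F.IsForest) {i : Fin m} {h : ℕ}
    (h1 : 1 ≤ h) {k : ι} (hk : i ∈ F.R k) (hle : h ≤ F.depth k) :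
    ∃ j, F.depth j = h ∧ i ∈ F.R j := by
  induction hd : F.depth k - h generalizing k with
  | zero => exact ⟨k, by omega, hk⟩
  | succ d ih =>
    obtain ⟨j, hj, hjd⟩ := hF.exists_parent hk (by omega)
    exact ih hj (by omega) (by omega)

theorem regionAt_eq_none_iff {F : RefFamily m ι} {i : Fin m} {h : ℕ} :
    F.regionAt i h = none ↔ ∀ k, F.depth k = h → i ∉ F.R k := by
  unfold regionAt
  split_ifs with hk
  · obtain ⟨k, h1, h2⟩ := hk
    simp only [false_iff, not_forall, not_not]
    exact ⟨k, h1, h2⟩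
  · simpa using hk

theorem regionAt_eq_some {F : RefFamily m ι} {i : Fin m} {h : ℕ} {k : ι}
    (hk : F.regionAt i h = some k) : F.depth k = h ∧ i ∈ F.R k := by
  unfold regionAt at hk
  split_ifs at hk with hex
  rw [← Option.some.inj hk]
  exact hex.choose_spec

theorem IsForest.regionAt_eq {F : RefFamily m ι} (hF : F.IsForest) {i : Fin m} {k : ι}
    (hk : i ∈ F.R k) : F.regionAt i (F.depth k) = some k := by
  cases hr : F.regionAt i (F.depth k) with
  | none => exact absurd hk (regionAt_eq_none_iff.1 hr k rfl)
  | some j =>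
    obtain ⟨h1, h2⟩ := regionAt_eq_some hr
    rw [hF.eq_of_depth_eq h2 hk h1]

theorem depth_le_hmax (F : RefFamily m ι) {i : Fin m} {k : ι} (hk : i ∈ F.R k) :
    F.depth k ≤ F.hmax i :=
  Finset.le_sup (f := F.depth) (by simpa using hk)

theorem hmax_le_height (F : RefFamily m ι) (i : Fin m) : F.hmax i ≤ F.height :=
  Finset.sup_mono (Finset.filter_subset _ _)

theorem height_le_card (F : RefFamily m ι) : F.height ≤ Fintype.card ι := by
  refine Finset.sup_le fun k _ => ?_
  have : (Finset.univ.filter fun k' => F.R k ⊂ F.R k').card < Fintype.card ι :=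
    Finset.card_lt_univ_of_notMem (x := k) (by simp)
  unfold depth
  omega

/-- In a forest, if `B` meets every region of `sat` in at least `ζ k` points, then no admissible
set meets the union of these regions in more points than `B`. -/
theorem IsForest.card_inter_biUnion_le [DecidableEq ι] {F : RefFamily m ι} (hF : F.IsForest)
    {A B : Finset (Fin m)} {sat : Finset ι} (hA : ∀ k, (F.R k ∩ A).card ≤ F.ζ k)
    (hB : ∀ k ∈ sat, F.ζ k ≤ (F.R k ∩ B).card) :
    (sat.biUnion F.R ∩ A).card ≤ (sat.biUnion F.R ∩ B).card := by
  -- The maximal regions of `sat` have the same union and are pairwise disjoint, so cardinalities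
  -- add up over them.
  set top : Finset ι := sat.filter fun k => ∀ j ∈ sat, F.R k ⊆ F.R j → j = k with htop
  have hcover : sat.biUnion F.R = top.biUnion F.R := by
    refine Finset.Subset.antisymm ?_ (Finset.biUnion_subset_biUnion_of_subset_left _
      (Finset.filter_subset _ _))
    intro x hx
    obtain ⟨k, hk, hxk⟩ := Finset.mem_biUnion.1 hx
    obtain ⟨j, hj, hmax⟩ := Finset.exists_max_image (sat.filter fun j => F.R k ⊆ F.R j)
      (fun j => (F.R j).card) ⟨k, by simpa using hk⟩
    simp only [Finset.mem_filter] at hj hmax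
    refine Finset.mem_biUnion.2 ⟨j, Finset.mem_filter.2 ⟨hj.1, fun l hl hjl => ?_⟩, hj.2 hxk⟩
    exact F.R_injective (Finset.eq_of_subset_of_card_le hjl (hmax l ⟨hl, hj.2.trans hjl⟩)).symm
  have hdisj : ∀ C : Finset (Fin m),
      (top : Set ι).PairwiseDisjoint fun k => F.R k ∩ C := by
    intro C j hj k hk hjk
    refine Finset.disjoint_left.2 fun x hx hx' => hjk ?_
    simp only [htop, Finset.coe_filter, Set.mem_ofPred_eq] at hj hk
    rcases hF.subset_or_subset (Finset.mem_inter.1 hx).1 (Finset.mem_inter.1 hx').1 with hs | hs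
    · exact (hj.2 k hk.1 hs).symm
    · exact hk.2 j hj.1 hs
  rw [hcover, Finset.biUnion_inter, Finset.biUnion_inter, Finset.card_biUnion (hdisj A),
    Finset.card_biUnion (hdisj B)]
  exact Finset.sum_le_sum fun k hk => (hA k).trans (hB k (Finset.mem_filter.1 hk).1)

end RefFamily

/-! ### The formal algorithm and its invariant -/

section Formal

variable {m : ℕ} {ι : Type} [Fintype ι] [DecidableEq ι]

/-- The effect of the inner loop from depth `a` on. -/
theorem formalLoop_spec {F : RefFamily m ι} (hF : F.IsForest) (i : Fin m) (n a : ℕ) (ha : 1 ≤ a)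
    (hn : F.hmax i < a + n) (s : FormalState ι) :
    let s' := formalLoop F i (List.range' a n) s
    s.sat ⊆ s'.sat ∧
    (∀ k ∈ s'.sat, k ∉ s.sat →
      i ∈ F.R k ∧ a ≤ F.depth k ∧ F.ζ k ≤ s'.eta k ∧ s'.eta k = s.eta k + 1) ∧
    (∀ k, i ∉ F.R k ∨ F.depth k < a → s'.eta k = s.eta k) ∧
    (∀ k, i ∈ F.R k → a ≤ F.depth k →
      (∃ j ∈ s'.sat, F.R k ⊆ F.R j) ∨ s'.eta k = s.eta k + 1 ∧ s'.eta k < F.ζ k) := by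
  induction n generalizing a s with
  | zero =>
    refine ⟨subset_rfl, fun k hk hk' => absurd hk hk', fun _ _ => rfl, fun k hk hd => ?_⟩
    have := F.depth_le_hmax hk
    omega
  | succ n ih =>
    rw [List.range'_succ]
    cases hr : F.regionAt i a with
    | none =>
      simp only [formalLoop, hr]
      refine ⟨subset_rfl, fun k hk hk' => absurd hk hk', fun _ _ => trivial, fun k hk hd => ?_⟩
      -- Depths of regions through `i` have no gaps: if none has depth `a`, none is deeper.
      obtain ⟨j, hj, hij⟩ := hF.exists_depth_eq ha hk hd
      exact absurd hij (RefFamily.regionAt_eq_none_iff.1 hr j hj)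
    | some j =>
      obtain ⟨hja, hij⟩ := RefFamily.regionAt_eq_some hr
      simp only [formalLoop, hr]
      split_ifs with hlt
      · obtain ⟨h1, h2, h3, h4⟩ := ih (a + 1) (by omega) (by omega)
          { s with eta := Function.update s.eta j (s.eta j + 1) }
        dsimp only at h1 h2 h3 h4
        -- The remaining loop starts at depth `a + 1`, so it leaves the counter of `j` alone.
        have hj' := h3 j (Or.inr (by omega))
        refine ⟨h1, fun k hk hk' => ?_, fun k hk => ?_, fun k hk hd => ?_⟩
        · obtain ⟨g1, g2, g3, g4⟩ := h2 k hk hk'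
          have hkj : k ≠ j := by rintro rfl; omega
          rw [Function.update_of_ne hkj] at g4
          exact ⟨g1, by omega, g3, g4⟩
        · have hkj : k ≠ j := by
            rintro rfl
            rcases hk with hk | hk
            · exact hk hij
            · omega
          rw [h3 k (hk.imp_right fun h => by omega), Function.update_of_ne hkj]
        · by_cases hkj : k = j
          · subst hkj
            rw [hj']
            refine Or.inr ⟨by simp, hlt⟩
          · have hne : F.depth k ≠ a := fun h =>
              hkj (hF.eq_of_depth_eq hk hij (h.trans hja.symm))
            have := h4 k hk (by omega)
            rwa [Function.update_of_ne hkj] at this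
      · refine ⟨Finset.subset_union_left, fun k hk hk' => ?_, fun k hk => ?_, fun k hk hd => ?_⟩
        · have hkj : k = j := by simpa [hk'] using hk
          subst hkj
          exact ⟨hij, hja.ge, by simpa using hlt, by simp⟩
        · have hkj : k ≠ j := by
            rintro rfl
            rcases hk with hk | hk
            · exact hk hij
            · omega
          exact Function.update_of_ne hkj _ _
        -- Stopping early is harmless: the deeper regions through `i`, whose counters are skipped,
        -- lie inside the newly saturated `j`.
        · exact Or.inl ⟨j, by simp, hF.subset_of_depth_le hij hk (by omega)⟩

/-- The invariant of the formal algorithm: `B` collects the processed hypotheses (among `S`) that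
were in no saturated region when they were added. -/
structure Invariant (F : RefFamily m ι) (s : FormalState ι) (S B : Finset (Fin m)) : Prop where
  subset : B ⊆ S
  -- Counters are exact only here: below a saturated region they may lag behind.
  eta_of_uncovered : ∀ k, (∀ j ∈ s.sat, ¬ F.R k ⊆ F.R j) →
    s.eta k = (F.R k ∩ B).card ∧ s.eta k < F.ζ k
  card_le : ∀ k, (F.R k ∩ B).card ≤ F.ζ k
  le_card : ∀ k ∈ s.sat, F.ζ k ≤ (F.R k ∩ B).card
  covered : ∀ x ∈ S, x ∉ B → ∃ k ∈ s.sat, x ∈ F.R k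

omit [DecidableEq ι] in
theorem Invariant.init (F : RefFamily m ι) : Invariant F (formalInit F) ∅ ∅ where
  subset := subset_rfl
  eta_of_uncovered k hk := by
    -- A region with bound zero is saturated and covers itself.
    have : F.ζ k ≠ 0 := fun h => hk k (by simpa [formalInit] using h) subset_rfl
    simpa [formalInit] using Nat.pos_of_ne_zero this
  card_le k := by simp
  le_card k hk := by
    have : F.ζ k = 0 := by simpa [formalInit] using hk
    simp [this]
  covered x hx := by simp at hx

/-- Split `S ∩ A` along the union `U` of the saturated regions: inside `U` saturation bounds `A` by
`B`, and outside `U` every point of `S` belongs to `B`. -/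
theorem Invariant.Vstar_eq {F : RefFamily m ι} (hF : F.IsForest) {s : FormalState ι}
    {S B : Finset (Fin m)} (h : Invariant F s S B) : F.Vstar S = B.card := by
  apply le_antisymm
  · refine Finset.sup_le fun A hA => ?_
    have hA' : ∀ k, (F.R k ∩ A).card ≤ F.ζ k := by
      simpa [RefFamily.admissible] using hA
    set U := s.sat.biUnion F.R with hU
    have hsub : S ∩ A ⊆ (U ∩ A) ∪ (B \ U) := by
      intro x hx
      obtain ⟨hxS, hxA⟩ := Finset.mem_inter.1 hx
      by_cases hxU : x ∈ U
      · exact Finset.mem_union_left _ (Finset.mem_inter.2 ⟨hxU, hxA⟩)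
      · refine Finset.mem_union_right _ (Finset.mem_sdiff.2 ⟨?_, hxU⟩)
        by_contra hxB
        exact hxU (Finset.mem_biUnion.2 (h.covered x hxS hxB))
    calc (S ∩ A).card ≤ ((U ∩ A) ∪ (B \ U)).card := Finset.card_le_card hsub
      _ ≤ (U ∩ A).card + (B \ U).card := Finset.card_union_le _ _
      _ ≤ (U ∩ B).card + (B \ U).card :=
        Nat.add_le_add_right (hF.card_inter_biUnion_le hA' h.le_card) _
      _ = B.card := by rw [Finset.inter_comm, Finset.card_inter_add_card_sdiff]
  · have hB : B ∈ F.admissible := by simpa [RefFamily.admissible] using h.card_le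
    have := Finset.le_sup (f := fun A => (S ∩ A).card) hB
    rwa [Finset.inter_eq_right.2 h.subset] at this

theorem Invariant.step_of_mem {F : RefFamily m ι} {s : FormalState ι} {S B : Finset (Fin m)}
    {i : Fin m} (h : Invariant F s S B) (hi : ∃ k ∈ s.sat, i ∈ F.R k) :
    Invariant F (formalStep F i s) (insert i S) B := by
  rw [formalStep, if_pos hi]
  refine ⟨h.subset.trans (Finset.subset_insert _ _), h.eta_of_uncovered, h.card_le, h.le_card,
    fun x hx hxB => ?_⟩
  rcases Finset.mem_insert.1 hx with rfl | hx
  · exact hi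
  · exact h.covered x hx hxB

/-- No region through `i` lies inside a saturated one, so all their counters are exact and strictly
below `ζ`. This leaves room for `i`, and a region saturated now has exactly reached its bound. -/
theorem Invariant.step_of_notMem {F : RefFamily m ι} (hF : F.IsForest) {s : FormalState ι}
    {S B : Finset (Fin m)} {i : Fin m} (h : Invariant F s S B) (hiS : i ∉ S)
    (hi : ¬ ∃ k ∈ s.sat, i ∈ F.R k) :
    Invariant F (formalStep F i s) (insert i S) (insert i B) := by
  rw [formalStep, if_neg hi]
  obtain ⟨h1, h2, h3, h4⟩ := formalLoop_spec hF i (F.hmax i) 1 le_rfl (by omega) s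
  set s' := formalLoop F i (List.range' 1 (F.hmax i)) s
  have hunc : ∀ k, i ∈ F.R k → ∀ j ∈ s.sat, ¬ F.R k ⊆ F.R j :=
    fun k hk j hj hkj => hi ⟨j, hj, hkj hk⟩
  have hiB : i ∉ B := fun hB => hiS (h.subset hB)
  have hin : ∀ k, i ∈ F.R k → (F.R k ∩ insert i B).card = (F.R k ∩ B).card + 1 := by
    intro k hk
    rw [Finset.inter_insert_of_mem hk, Finset.card_insert_of_notMem (by simp [hiB])]
  have hout : ∀ k, i ∉ F.R k → F.R k ∩ insert i B = F.R k ∩ B :=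
    fun k hk => Finset.inter_insert_of_notMem hk
  have hdepth : ∀ k, 1 ≤ F.depth k := fun k => Nat.le_add_right _ _
  refine ⟨Finset.insert_subset_insert _ h.subset, fun k hk => ?_, fun k => ?_, fun k hk => ?_,
    fun x hx hxB => ?_⟩
  · obtain ⟨g1, g2⟩ := h.eta_of_uncovered k fun j hj => hk j (h1 hj)
    by_cases hik : i ∈ F.R k
    · rcases h4 k hik (hdepth k) with ⟨j, hj, hkj⟩ | ⟨e1, e2⟩
      · exact absurd hkj (hk j hj)
      · exact ⟨by rw [e1, hin k hik, g1], e2⟩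
    · rw [h3 k (Or.inl hik), hout k hik]
      exact ⟨g1, g2⟩
  · by_cases hik : i ∈ F.R k
    · obtain ⟨g1, g2⟩ := h.eta_of_uncovered k (hunc k hik)
      rw [hin k hik]
      omega
    · rw [hout k hik]
      exact h.card_le k
  · by_cases hks : k ∈ s.sat
    · exact (h.le_card k hks).trans
        (Finset.card_le_card (Finset.inter_subset_inter_left (Finset.subset_insert _ _)))
    · obtain ⟨hik, -, e1, e2⟩ := h2 k hk hks
      obtain ⟨g1, -⟩ := h.eta_of_uncovered k (hunc k hik)
      rw [hin k hik]
      omega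
  · rw [Finset.mem_insert, not_or] at hxB
    obtain ⟨k, hk, hxk⟩ := h.covered x ((Finset.mem_insert.1 hx).resolve_left hxB.1) hxB.2
    exact ⟨k, h1 hk, hxk⟩

theorem pathSet_zero (σ : Equiv.Perm (Fin m)) : pathSet σ 0 = ∅ := by
  simp [pathSet]

theorem pathSet_succ (σ : Equiv.Perm (Fin m)) {t : ℕ} (ht : t < m) :
    pathSet σ (t + 1) = insert (σ ⟨t, ht⟩) (pathSet σ t) := by
  unfold pathSet
  rw [← Finset.image_insert]
  congr 1
  ext j
  simp only [Finset.mem_filter, Finset.mem_univ, true_and, Finset.mem_insert, Fin.ext_iff]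
  omega

theorem notMem_pathSet (σ : Equiv.Perm (Fin m)) {t : ℕ} (ht : t < m) :
    σ ⟨t, ht⟩ ∉ pathSet σ t := by
  simp [pathSet]

theorem formalState_succ (F : RefFamily m ι) (σ : Equiv.Perm (Fin m)) {t : ℕ} (ht : t < m) :
    formalState F σ (t + 1) = formalStep F (σ ⟨t, ht⟩) (formalState F σ t) := by
  rw [formalState, dif_pos ht]

theorem exists_invariant {F : RefFamily m ι} (hF : F.IsForest) (σ : Equiv.Perm (Fin m)) {t : ℕ}
    (ht : t ≤ m) : ∃ B, Invariant F (formalState F σ t) (pathSet σ t) B := by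
  induction t with
  | zero => exact ⟨∅, by rw [pathSet_zero]; exact Invariant.init F⟩
  | succ t ih =>
    obtain ⟨B, hB⟩ := ih (by omega)
    have ht' : t < m := ht
    rw [formalState_succ F σ ht', pathSet_succ σ ht']
    by_cases hi : ∃ k ∈ (formalState F σ t).sat, σ ⟨t, ht'⟩ ∈ F.R k
    · exact ⟨B, hB.step_of_mem hi⟩
    · exact ⟨_, hB.step_of_notMem hF (notMem_pathSet σ ht') hi⟩

theorem Vstar_pathSet_succ_of_mem {F : RefFamily m ι} (hF : F.IsForest) (σ : Equiv.Perm (Fin m))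
    {t : ℕ} (ht : t < m) (hi : ∃ k ∈ saturated F σ t, σ ⟨t, ht⟩ ∈ F.R k) :
    F.Vstar (pathSet σ (t + 1)) = F.Vstar (pathSet σ t) := by
  obtain ⟨B, hB⟩ := exists_invariant hF σ ht.le
  rw [pathSet_succ σ ht, hB.Vstar_eq hF, (hB.step_of_mem hi).Vstar_eq hF]

theorem Vstar_pathSet_succ_of_notMem {F : RefFamily m ι} (hF : F.IsForest)
    (σ : Equiv.Perm (Fin m)) {t : ℕ} (ht : t < m)
    (hi : ¬ ∃ k ∈ saturated F σ t, σ ⟨t, ht⟩ ∈ F.R k) :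
    F.Vstar (pathSet σ (t + 1)) = F.Vstar (pathSet σ t) + 1 := by
  obtain ⟨B, hB⟩ := exists_invariant hF σ ht.le
  have hiS := notMem_pathSet σ ht
  rw [pathSet_succ σ ht, hB.Vstar_eq hF, (hB.step_of_notMem hF hiS hi).Vstar_eq hF,
    Finset.card_insert_of_notMem fun h => hiS (hB.subset h)]

end Formal

/-! ### Values and costs of timed computations -/

namespace Timed

variable {α β : Type}

@[simp] theorem pure_val (a : α) : (pure a : Timed α).val = a := rfl

@[simp] theorem pure_cost (a : α) : (pure a : Timed α).cost = 0 := rfl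

@[simp] theorem bind_val (x : Timed α) (f : α → Timed β) : (x >>= f).val = (f x.val).val := rfl

@[simp] theorem bind_cost (x : Timed α) (f : α → Timed β) :
    (x >>= f).cost = x.cost + (f x.val).cost := rfl

@[simp] theorem tick_cost (n : ℕ) : (tick n).cost = n := rfl

end Timed

/-! ### Scans of the practical algorithm and their costs -/

section Practical

variable {m : ℕ} {ι : Type} [DecidableEq ι]

theorem initState_eta (F : RefFamily m ι) (regions : List ι) :
    (initState F regions).val.eta = fun _ => 0 := by
  induction regions with
  | nil => rfl
  | cons k ks ih =>
    simp only [initState, Timed.bind_val]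
    split_ifs <;> simp [ih]

theorem mem_initState_sat (F : RefFamily m ι) (regions : List ι) (j : ι) :
    j ∈ (initState F regions).val.sat ↔ j ∈ regions ∧ F.ζ j = 0 := by
  induction regions with
  | nil => simp [initState]
  | cons k ks ih =>
    simp only [initState, Timed.bind_val]
    split_ifs with hk
    · simp only [Timed.bind_val, Timed.pure_val, Finset.mem_insert, ih, List.mem_cons]
      constructor
      · rintro (rfl | h)
        · exact ⟨Or.inl rfl, hk⟩
        · exact ⟨Or.inr h.1, h.2⟩
      · tauto
    · simp only [Timed.pure_val, ih, List.mem_cons]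
      constructor
      · tauto
      · rintro ⟨rfl | h, h'⟩
        · exact absurd h' hk
        · exact ⟨h, h'⟩

theorem initState_cost_le (F : RefFamily m ι) (regions : List ι) :
    (initState F regions).cost ≤ 3 * regions.length := by
  induction regions with
  | nil => simp [initState]
  | cons k ks ih =>
    simp only [initState, Timed.bind_cost, Timed.tick_cost, List.length_cons]
    split_ifs <;> simp <;> omega

theorem testSaturated_val (F : RefFamily m ι) (i : Fin m) (sat : Finset ι) (regions : List ι) :
    (testSaturated F i sat regions).val = true ↔ ∃ k ∈ regions, k ∈ sat ∧ i ∈ F.R k := by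
  induction regions with
  | nil => simp [testSaturated]
  | cons k ks ih =>
    simp only [testSaturated, Timed.bind_val, List.exists_mem_cons_iff]
    split_ifs with h1 h2
    · simp [h1, h2]
    · simp [ih, h2]
    · simp [ih, h1]

theorem testSaturated_cost_le (F : RefFamily m ι) (i : Fin m) (sat : Finset ι)
    (regions : List ι) : (testSaturated F i sat regions).cost ≤ 2 * regions.length := by
  induction regions with
  | nil => simp [testSaturated]
  | cons k ks ih =>
    simp only [testSaturated, Timed.bind_cost, Timed.tick_cost, List.length_cons]
    split_ifs
    · simp only [Timed.bind_cost, Timed.tick_cost, Timed.pure_cost]; omega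
    · simp only [Timed.bind_cost, Timed.tick_cost]; omega
    · omega

omit [DecidableEq ι] in
theorem findRegion_cost_le (F : RefFamily m ι) (i : Fin m) (layer : List ι) :
    (findRegion F i layer).cost ≤ layer.length := by
  induction layer with
  | nil => simp [findRegion]
  | cons k ks ih =>
    simp only [findRegion, Timed.bind_cost, Timed.tick_cost, List.length_cons]
    split_ifs
    · simp only [Timed.pure_cost]; omega
    · omega

omit [DecidableEq ι] in
theorem findRegion_val_eq_none {F : RefFamily m ι} {i : Fin m} {layer : List ι}
    (h : (findRegion F i layer).val = none) : ∀ k ∈ layer, i ∉ F.R k := by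
  induction layer with
  | nil => simp
  | cons k ks ih =>
    simp only [findRegion, Timed.bind_val] at h
    split_ifs at h with hk
    exact List.forall_mem_cons.2 ⟨hk, ih h⟩

omit [DecidableEq ι] in
theorem findRegion_val_eq_some {F : RefFamily m ι} {i : Fin m} {layer : List ι} {k : ι}
    (h : (findRegion F i layer).val = some k) : k ∈ layer ∧ i ∈ F.R k := by
  induction layer with
  | nil => simp [findRegion] at h
  | cons j js ih =>
    simp only [findRegion, Timed.bind_val] at h
    split_ifs at h with hj
    · rw [Timed.pure_val, Option.some.injEq] at h
      subst h
      exact ⟨List.mem_cons_self, hj⟩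
    · exact ⟨List.mem_cons_of_mem _ (ih h).1, (ih h).2⟩

/-- The 4 pays for loop control, increment, comparison and mark; the sum pays for the searches. -/
theorem visitLayers_cost_le (F : RefFamily m ι) (i : Fin m) (layers : List (List ι))
    (s : PracticalState ι) :
    (visitLayers F i layers s).cost ≤ 4 * layers.length + (layers.map List.length).sum := by
  induction layers generalizing s with
  | nil => simp [visitLayers]
  | cons layer layers ih =>
    have hf := findRegion_cost_le F i layer
    simp only [visitLayers, Timed.bind_cost, Timed.tick_cost, List.length_cons, List.map_cons,
      List.sum_cons]
    cases (findRegion F i layer).val with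
    | none => simp only [Timed.pure_cost]; omega
    | some k =>
      simp only [Timed.bind_cost, Timed.tick_cost]
      split_ifs
      · have := ih ⟨s.sat, Function.update s.eta k (s.eta k + 1)⟩
        omega
      · simp only [Timed.bind_cost, Timed.tick_cost, Timed.pure_cost]; omega

theorem curveLoop_cost_le (F : RefFamily m ι) (regions : List ι) (layers : List (List ι))
    (path : List (Fin m)) (V : ℕ) (s : PracticalState ι) :
    (curveLoop F regions layers path V s).cost ≤ path.length *
      (2 + 2 * regions.length + (4 * layers.length + (layers.map List.length).sum)) := by
  induction path generalizing V s with
  | nil => simp [curveLoop]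
  | cons i path ih =>
    have h1 := testSaturated_cost_le F i s.sat regions
    have h2 := visitLayers_cost_le F i layers s
    simp only [curveLoop, Timed.bind_cost, Timed.tick_cost, List.length_cons]
    rw [Nat.add_one_mul path.length]
    split_ifs
    · have h3 := ih V s
      simp only [Timed.bind_cost, Timed.tick_cost, Timed.pure_cost]
      omega
    · have h3 := ih (V + 1) (visitLayers F i layers s).val
      simp only [Timed.bind_cost, Timed.tick_cost, Timed.pure_cost]
      omega

end Practical

/-! ### Total cost, and simulation of the formal algorithm -/

section Correctness

variable {m : ℕ} {ι : Type} [Fintype ι] [DecidableEq ι]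

-- Each region has one depth, so it is counted in at most one layer. This avoids a factor `H` in the
-- running time.
omit [DecidableEq ι] in
theorem sum_length_filter_depth_le (F : RefFamily m ι) (regions : List ι) {l : List ℕ}
    (hl : l.Nodup) :
    (l.map fun h => (regions.filter fun k => F.depth k = h).length).sum ≤ regions.length := by
  induction regions with
  | nil => simp
  | cons k ks ih =>
    have hsum : (l.map fun h => ((k :: ks).filter fun k => F.depth k = h).length) =
        l.map fun h => (if F.depth k = h then 1 else 0) +
          (ks.filter fun k => F.depth k = h).length := by
      refine List.map_congr_left fun h _ => ?_
      by_cases hk : F.depth k = h <;> simp [hk, Nat.add_comm]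
    -- The sum is the multiplicity of `F.depth k` in the duplicate-free list `l`.
    have hone : (l.map fun h => if F.depth k = h then 1 else 0).sum ≤ 1 := by
      have hc := List.nodup_iff_count_le_one.1 hl (F.depth k)
      rw [List.count, List.countP_eq_length_filter] at hc
      refine le_trans (le_of_eq ?_) hc
      clear hc hl hsum ih
      induction l with
      | nil => rfl
      | cons h l ih =>
        by_cases hk : F.depth k = h
        · subst hk
          simp only [List.map_cons, List.sum_cons, if_true, ih]
          simp [Nat.add_comm]
        · have hk' : h ≠ F.depth k := fun h' => hk h'.symm
          simp only [List.map_cons, List.sum_cons, if_neg hk, ih]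
          simp [hk']
    rw [hsum, List.sum_map_add, List.length_cons]
    omega

omit [DecidableEq ι] in
theorem sum_length_storedLayers_le (F : RefFamily m ι) (regions : List ι) :
    ((storedLayers F regions).map List.length).sum ≤ regions.length := by
  rw [storedLayers, List.map_map]
  exact sum_length_filter_depth_le F regions List.nodup_range'

theorem practicalCurve_cost_le (F : RefFamily m ι) (regions : List ι)
    (σ : Equiv.Perm (Fin m)) :
    (practicalCurve F regions σ).cost ≤ 1 + 3 * regions.length +
      m * (2 + 3 * regions.length + 4 * Fintype.card ι) := by
  have h1 := initState_cost_le F regions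
  have h2 := curveLoop_cost_le F regions (storedLayers F regions) (List.ofFn σ) 0
    (initState F regions).val
  have h3 := sum_length_storedLayers_le F regions
  have h4 : (storedLayers F regions).length ≤ Fintype.card ι := by
    simpa [storedLayers] using F.height_le_card
  rw [List.length_ofFn] at h2
  have h5 := Nat.mul_le_mul_left m (show 2 + 2 * regions.length +
    (4 * (storedLayers F regions).length + ((storedLayers F regions).map List.length).sum) ≤
      2 + 3 * regions.length + 4 * Fintype.card ι by omega)
  simp only [practicalCurve, Timed.bind_cost, Timed.tick_cost, Timed.pure_cost]
  omega

-- At most one region of depth `h` contains `i`, so neither the scan order nor the choice in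
-- `regionAt` matters.
omit [DecidableEq ι] in
theorem findRegion_layer_val {F : RefFamily m ι} (hF : F.IsForest) (i : Fin m)
    {regions : List ι} (hall : ∀ k, k ∈ regions) (h : ℕ) :
    (findRegion F i (regions.filter fun k => F.depth k = h)).val = F.regionAt i h := by
  cases hr : (findRegion F i (regions.filter fun k => F.depth k = h)).val with
  | none =>
    refine (RefFamily.regionAt_eq_none_iff.2 fun k hk => ?_).symm
    exact findRegion_val_eq_none hr k (List.mem_filter.2 ⟨hall k, by simpa using hk⟩)
  | some k =>
    obtain ⟨h1, h2⟩ := findRegion_val_eq_some hr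
    have hd : F.depth k = h := by simpa using (List.mem_filter.1 h1).2
    rw [← hd, hF.regionAt_eq h2]

theorem visitLayers_val {F : RefFamily m ι} (hF : F.IsForest) (i : Fin m) {regions : List ι}
    (hall : ∀ k, k ∈ regions) (l : List ℕ) (s : FormalState ι) :
    (visitLayers F i (l.map fun h => regions.filter fun k => F.depth k = h)
      ⟨s.sat, s.eta⟩).val = ⟨(formalLoop F i l s).sat, (formalLoop F i l s).eta⟩ := by
  induction l generalizing s with
  | nil => rfl
  | cons h l ih =>
    simp only [List.map_cons, visitLayers, formalLoop, Timed.bind_val,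
      findRegion_layer_val hF i hall h]
    cases F.regionAt i h with
    | none => rfl
    | some k =>
      simp only [Timed.bind_val]
      split_ifs
      · exact ih { s with eta := Function.update s.eta k (s.eta k + 1) }
      · simp only [Timed.bind_val, Timed.pure_val, Finset.union_singleton]

/-- Reconciles the two loop ranges: the formal loop stops at `hmax i`, the stored layers continue to
`height`. -/
theorem formalLoop_append {F : RefFamily m ι} {i : Fin m} (l l' : List ℕ)
    (h : ∀ d ∈ l', F.regionAt i d = none) (s : FormalState ι) :
    formalLoop F i (l ++ l') s = formalLoop F i l s := by
  induction l generalizing s with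
  | nil =>
    cases l' with
    | nil => rfl
    | cons d l' => simp only [List.nil_append, formalLoop, h d List.mem_cons_self]
  | cons d l ih =>
    simp only [List.cons_append, formalLoop]
    cases F.regionAt i d with
    | none => rfl
    | some k => simp only [ih]

theorem visitLayers_storedLayers_val {F : RefFamily m ι} (hF : F.IsForest) (i : Fin m)
    {regions : List ι} (hall : ∀ k, k ∈ regions) (s : FormalState ι)
    (hi : ¬ ∃ k ∈ s.sat, i ∈ F.R k) :
    (visitLayers F i (storedLayers F regions) ⟨s.sat, s.eta⟩).val =
      ⟨(formalStep F i s).sat, (formalStep F i s).eta⟩ := by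
  obtain ⟨d, hd⟩ := Nat.exists_eq_add_of_le (F.hmax_le_height i)
  rw [storedLayers, visitLayers_val hF i hall, formalStep, if_neg hi, hd,
    ← List.range'_append_1, formalLoop_append]
  intro h hh
  refine RefFamily.regionAt_eq_none_iff.2 fun k hk hik => ?_
  have := F.depth_le_hmax hik
  have := (List.mem_range'_1.1 hh).1
  omega

theorem curveLoop_val {F : RefFamily m ι} (hF : F.IsForest) (σ : Equiv.Perm (Fin m))
    {regions : List ι} (hall : ∀ k, k ∈ regions) (n t : ℕ) (ht : t + n = m) :
    (curveLoop F regions (storedLayers F regions) ((List.ofFn σ).drop t)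
      (F.Vstar (pathSet σ t)) ⟨(formalState F σ t).sat, (formalState F σ t).eta⟩).val =
      (List.range' (t + 1) n).map fun u => F.Vstar (pathSet σ u) := by
  induction n generalizing t with
  | zero =>
    rw [List.drop_eq_nil_of_le (by simp; omega)]
    rfl
  | succ n ih =>
    have htm : t < m := by omega
    have ih' := ih (t + 1) (by omega)
    rw [List.drop_eq_getElem_cons (by simpa using htm), List.getElem_ofFn, List.range'_succ,
      List.map_cons]
    have htest := testSaturated_val F (σ ⟨t, htm⟩) (formalState F σ t).sat regions
    simp only [hall, true_and] at htest
    simp only [curveLoop, Timed.bind_val]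
    by_cases hi : ∃ k ∈ (formalState F σ t).sat, σ ⟨t, htm⟩ ∈ F.R k
    · rw [formalState_succ F σ htm, formalStep, if_pos hi,
        Vstar_pathSet_succ_of_mem hF σ htm hi] at ih'
      rw [if_pos (htest.2 hi), Vstar_pathSet_succ_of_mem hF σ htm hi]
      simp only [Timed.bind_val, Timed.pure_val]
      rw [ih']
    · rw [formalState_succ F σ htm, Vstar_pathSet_succ_of_notMem hF σ htm hi] at ih'
      rw [if_neg (fun h => hi (htest.1 h)), Vstar_pathSet_succ_of_notMem hF σ htm hi]
      simp only [Timed.bind_val, Timed.pure_val]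
      rw [visitLayers_storedLayers_val hF _ hall _ hi, ih']

theorem practicalCurve_val {F : RefFamily m ι} (hF : F.IsForest) (σ : Equiv.Perm (Fin m))
    {regions : List ι} (hall : ∀ k, k ∈ regions) :
    (practicalCurve F regions σ).val =
      (List.range (m + 1)).map fun t => F.Vstar (pathSet σ t) := by
  have hV : F.Vstar (pathSet σ 0) = 0 := by
    rw [pathSet_zero, (Invariant.init F).Vstar_eq hF, Finset.card_empty]
  have hs : (initState F regions).val =
      ⟨(formalState F σ 0).sat, (formalState F σ 0).eta⟩ := by
    have h1 : (initState F regions).val.sat = (formalState F σ 0).sat := by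
      ext j
      simp [mem_initState_sat, hall, formalState, formalInit]
    rw [← h1, show (formalState F σ 0).eta = (initState F regions).val.eta from
      (initState_eta F regions).symm]
  have hc := curveLoop_val hF σ hall m 0 (by omega)
  rw [hV, List.drop_zero, ← hs] at hc
  simp only [practicalCurve, Timed.bind_val, Timed.pure_val]
  rw [hc, List.range_eq_range', List.range'_succ, List.map_cons, hV]

end Correctness

end PostHoc

theorem mainTheorem2 :
    ∃ C : ℕ, ∀ (m : ℕ) (_ : 1 ≤ m) (ι : Type) [Fintype ι] [DecidableEq ι]
      (F : PostHoc.RefFamily m ι) (_ : F.IsForest) (_ : F.IsComplete)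
      (σ : Equiv.Perm (Fin m)),
      (∀ (t : ℕ) (ht : t < m),
        ((∃ k ∈ PostHoc.saturated F σ t, σ ⟨t, ht⟩ ∈ F.R k) →
          F.Vstar (PostHoc.pathSet σ (t + 1)) = F.Vstar (PostHoc.pathSet σ t)) ∧
        ((¬ ∃ k ∈ PostHoc.saturated F σ t, σ ⟨t, ht⟩ ∈ F.R k) →
          F.Vstar (PostHoc.pathSet σ (t + 1)) = F.Vstar (PostHoc.pathSet σ t) + 1)) ∧
      (∀ (regions : List ι) (_ : regions.Nodup) (_ : ∀ k, k ∈ regions),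
        (PostHoc.practicalCurve F regions σ).val =
          (List.range (m + 1)).map (fun t => F.Vstar (PostHoc.pathSet σ t)) ∧
        (PostHoc.practicalCurve F regions σ).cost ≤ C * (m * Fintype.card ι)) := by
  -- With `K = |𝒦|`, the cost is at most `1 + 3K + 2m + 7mK`; as `m, K ≥ 1`, the coefficients add up
  -- to 13.
  refine ⟨13, fun m hm ι _ _ F hF hcomplete σ => ⟨fun t ht =>
    ⟨PostHoc.Vstar_pathSet_succ_of_mem hF σ ht, PostHoc.Vstar_pathSet_succ_of_notMem hF σ ht⟩,
    fun regions hnodup hall => ⟨PostHoc.practicalCurve_val hF σ hall, ?_⟩⟩⟩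
  -- Completeness makes the leaf of the first hypothesis a region, hence `K ≥ 1`.
  obtain ⟨k, -⟩ := hcomplete ⟨0, hm⟩
  have hK : 1 ≤ Fintype.card ι := Fintype.card_pos_iff.2 ⟨k⟩
  have hlen : regions.length = Fintype.card ι := by
    rw [← List.toFinset_card_of_nodup hnodup, ← Finset.card_univ]
    congr 1
    ext j
    simp [hall]
  have h := PostHoc.practicalCurve_cost_le F regions σ
  rw [hlen] at h
  nlinarith [Nat.mul_le_mul hm hK, Nat.mul_le_mul_left m hK,
    Nat.mul_le_mul_right (Fintype.card ι) hm]
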